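/- Let $q$ be a prime power, let $\mathbb{F}_q$ be the field with $q$ elements, and let $1 \le k < n$ be integers. For a random variable $X$ with values in $\mathbb{F}_q^m$, let $$\mathbf{H}^q_\infty(X) = -\log_q\Big(\max_{w \in \mathbb{F}_q^m} \Pr[X = w]\Big)$$ denote its $q$-ary min-entropy. Then for every random variable $R$ with values in $\mathbb{F}_q^n$ there exists an onto linear map $\varphi : \mathbb{F}_q^n \to \mathbb{F}_q^{n-k}$ such that $$\mathbf{H}^q_\infty(\varphi(R)) \ \ge\ \frac{n-k}{n}\,\mathbf{H}^q_\infty(R) \;-\; k\,\log_q\big(2 - q^{-1}\big).$$ -/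

import Mathlib

open MeasureTheory

/-- The `q`-ary min-entropy `-log_q (max_w Pr[X = w])` of a random variable `X` on a probability
space `(Ω, μ)` with values in a finite nonempty type `V` (over which the supremum is a maximum). -/
noncomputable def minEntropy {Ω V : Type*} [MeasurableSpace Ω] (q : ℕ) (μ : Measure Ω)
    (X : Ω → V) : ℝ :=
  -Real.logb (q : ℝ) (⨆ w : V, μ.real (X ⁻¹' {w}))

/-! The map is a composite of `k` projections along single lines. For a distribution `p` on `K ^ N`
with weights at most `M`, put `r = p ^ (1 / N)`, so that `∑ r ^ N = 1` and `p ≤ r * M ^ ((N - 1) /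
N)`. It then suffices to find a direction `d` in which every line sum of `r` is at most `2 - 1 / q`
(`exists_direction_sum_le`); the exponents telescope over the `k` steps.

The direction comes from the method of multiplicities. Scale `r` up to integer multiplicities `m`; a
dimension count gives a nonzero `P` of degree at most `D` vanishing to order `m x` at every `x`. By
Schwartz–Zippel with multiplicities, some Hasse derivative of the top form of `P`, of index `e` with
`q * |e| ≤ deg P`, is nonzero at some `d ≠ 0`. On each line in direction `d` the same derivative of
`P` is a nonzero polynomial of degree at most `deg P - |e|`, with a zero of order at least `m - |e|`
at each point. Hence `∑ m ≤ deg P + (q - 1) * |e| ≤ (2 - 1 / q) * D`. -/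

namespace MvPolynomial

/-! ### Taylor shifts and Hasse derivatives -/

section Shift

variable {σ K R : Type*} [Field K] [CommRing R] [Algebra K R]

/-- The Taylor expansion `P (a + X)` of a polynomial at a point `a` with coordinates in an
algebra; its coefficients are the Hasse derivatives of `P` at `a`. -/
noncomputable def taylorAt (a : σ → R) : MvPolynomial σ K →ₐ[K] MvPolynomial σ R :=
  aeval (fun i => X i + C (a i))

@[simp] lemma taylorAt_X (a : σ → R) (i : σ) :
    taylorAt (K := K) a (X i) = X i + C (a i) := by
  simp [taylorAt]

@[simp] lemma taylorAt_C (a : σ → R) (c : K) :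
    taylorAt (K := K) a (C c) = C (algebraMap K R c) := by
  rw [← algebraMap_eq, AlgHom.commutes]; rfl

lemma taylorAt_taylorAt (a : σ → K) (b : σ → R) (P : MvPolynomial σ K) :
    taylorAt b (taylorAt a P) = taylorAt (fun i => algebraMap K R (a i) + b i) P := by
  have : (taylorAt b).comp (taylorAt a) =
      taylorAt (K := K) (fun i => algebraMap K R (a i) + b i) := by
    apply algHom_ext
    intro i
    simp only [AlgHom.comp_apply, taylorAt_X, map_add, taylorAt_C]
    ring
  exact DFunLike.congr_fun this P

variable [Fintype σ]

lemma coeff_prod_X_add_C_pow (a : σ → R) (f e : σ →₀ ℕ) :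
    coeff e (∏ i, (X i + C (a i)) ^ f i : MvPolynomial σ R) =
      ∏ i, (((f i).choose (e i) : ℕ) : R) * a i ^ (f i - e i) := by
  classical
  have h1 : ∀ i : σ, (X i + C (a i) : MvPolynomial σ R) ^ f i =
      ∑ m ∈ Finset.range (f i + 1),
        C ((((f i).choose m : ℕ) : R) * a i ^ (f i - m)) * X i ^ m := by
    intro i
    rw [add_pow]
    refine Finset.sum_congr rfl fun m _ => ?_
    simp only [map_mul, map_natCast, map_pow]
    ring
  simp_rw [h1]
  rw [Finset.prod_univ_sum, coeff_sum]
  have h2 : ∀ p : σ → ℕ, coeff e (∏ i, C ((((f i).choose (p i) : ℕ) : R) * a i ^ (f i - p i)) *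
      X i ^ p i : MvPolynomial σ R) = if p = e then
        ∏ i, (((f i).choose (e i) : ℕ) : R) * a i ^ (f i - e i) else 0 := by
    intro p
    have : (∏ i, X i ^ p i : MvPolynomial σ R) = monomial (Finsupp.equivFunOnFinite.symm p) 1 := by
      rw [monomial_eq, Finsupp.prod_fintype _ _ (by simp)]
      simp
    rw [Finset.prod_mul_distrib, this, ← map_prod, coeff_C_mul, coeff_monomial]
    by_cases h : p = e
    · subst h
      rw [if_pos (by ext; simp), if_pos rfl, mul_one]
    · rw [if_neg (fun h' => h (by rw [← h']; rfl)), if_neg h, mul_zero]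
  simp_rw [h2]
  rw [Finset.sum_ite_eq']
  split_ifs with h
  · rfl
  · simp only [Fintype.mem_piFinset, Finset.mem_range, not_forall, not_lt] at h
    obtain ⟨i, hi⟩ := h
    symm
    apply Finset.prod_eq_zero (Finset.mem_univ i)
    rw [Nat.choose_eq_zero_of_lt (by omega)]
    simp

lemma coeff_taylorAt (a : σ → R) (P : MvPolynomial σ K) (e : σ →₀ ℕ) {S : Finset (σ →₀ ℕ)}
    (hS : P.support ⊆ S) :
    coeff e (taylorAt a P) = ∑ f ∈ S, algebraMap K R (coeff f P) *
      ∏ i, (((f i).choose (e i) : ℕ) : R) * a i ^ (f i - e i) := by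
  have h : P = ∑ f ∈ S, monomial f (coeff f P) := by
    conv_lhs => rw [P.as_sum]
    exact Finset.sum_subset hS fun f _ hf => by simp [notMem_support_iff.mp hf]
  conv_lhs => rw [h]
  rw [map_sum, coeff_sum]
  refine Finset.sum_congr rfl fun f _ => ?_
  rw [taylorAt, aeval_monomial, Finsupp.prod_fintype _ _ (by simp), IsScalarTower.algebraMap_apply
    K R (MvPolynomial σ R), algebraMap_eq, coeff_C_mul, coeff_prod_X_add_C_pow]

lemma prod_choose_eq_zero (a : σ → R) {f e : σ →₀ ℕ} (h : ¬ e ≤ f) :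
    ∏ i, (((f i).choose (e i) : ℕ) : R) * a i ^ (f i - e i) = 0 := by
  rw [Finsupp.le_def, not_forall] at h
  obtain ⟨i, hi⟩ := h
  apply Finset.prod_eq_zero (Finset.mem_univ i)
  rw [Nat.choose_eq_zero_of_lt (by omega)]
  simp

lemma sum_sub_eq_degree_sub {f e : σ →₀ ℕ} (h : e ≤ f) :
    ∑ i, (f i - e i) = f.degree - e.degree := by
  rw [Finsupp.degree_eq_sum, Finsupp.degree_eq_sum, Finset.sum_tsub_distrib _ fun i _ => h i]

end Shift

/-! ### Hasse derivatives along a line -/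

section Line

open Polynomial in
lemma _root_.Polynomial.coeff_prod_sum_of_natDegree_le {ι R : Type*} [CommRing R] (s : Finset ι)
    (f : ι → R[X]) (k : ι → ℕ) (h : ∀ i ∈ s, (f i).natDegree ≤ k i) :
    (∏ i ∈ s, f i).coeff (∑ i ∈ s, k i) = ∏ i ∈ s, (f i).coeff (k i) := by
  classical
  induction s using Finset.induction_on with
  | empty => simp
  | insert a s ha ih =>
    rw [Finset.prod_insert ha, Finset.prod_insert ha, Finset.sum_insert ha,
      coeff_mul_add_eq_of_natDegree_le (h a (by simp)), ih fun i hi => h i (by simp [hi])]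
    exact (natDegree_prod_le _ _).trans (Finset.sum_le_sum fun i hi => h i (by simp [hi]))

open Polynomial in
lemma _root_.Polynomial.natDegree_le_sum_of_prod {ι R : Type*} [CommRing R] (s : Finset ι)
    (f : ι → R[X]) (k : ι → ℕ) (h : ∀ i ∈ s, (f i).natDegree ≤ k i) :
    (∏ i ∈ s, f i).natDegree ≤ ∑ i ∈ s, k i :=
  (natDegree_prod_le _ _).trans (Finset.sum_le_sum h)

variable {σ K : Type*} [Field K]

open Polynomial in
/-- The Hasse derivative of `P` of index `e`, restricted to the line through `x` in
direction `d`. -/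
noncomputable def lineDeriv (P : MvPolynomial σ K) (x d : σ → K) (e : σ →₀ ℕ) : K[X] :=
  coeff e (taylorAt (fun i => Polynomial.C (x i) + Polynomial.X * Polynomial.C (d i)) P)

open Polynomial in
lemma natDegree_lineDeriv_factor (x d : σ → K) (f e : σ →₀ ℕ) (i : σ) :
    ((((f i).choose (e i) : ℕ) : K[X]) *
      (Polynomial.C (x i) + Polynomial.X * Polynomial.C (d i)) ^ (f i - e i)).natDegree
      ≤ f i - e i := by
  compute_degree

open Polynomial in
lemma coeff_lineDeriv_factor (x d : σ → K) (f e : σ →₀ ℕ) (i : σ) :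
    ((((f i).choose (e i) : ℕ) : K[X]) *
      (Polynomial.C (x i) + Polynomial.X * Polynomial.C (d i)) ^ (f i - e i)).coeff (f i - e i)
      = (((f i).choose (e i) : ℕ) : K) * d i ^ (f i - e i) := by
  rw [← Polynomial.C_eq_natCast, Polynomial.coeff_C_mul]
  congr 1
  have := Polynomial.coeff_pow_of_natDegree_le
    (p := Polynomial.C (x i) + Polynomial.X * Polynomial.C (d i)) (m := f i - e i) (n := 1)
    (by compute_degree)
  rw [mul_one] at this
  rw [this]
  simp

variable [Fintype σ]

lemma natDegree_lineDeriv_le (P : MvPolynomial σ K) (x d : σ → K) (e : σ →₀ ℕ) :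
    (lineDeriv P x d e).natDegree ≤ P.totalDegree - e.degree := by
  rw [lineDeriv, coeff_taylorAt _ _ _ subset_rfl]
  refine Polynomial.natDegree_sum_le_of_forall_le _ _ fun f hf => ?_
  by_cases h : e ≤ f
  · refine (Polynomial.natDegree_C_mul_le _ _).trans ?_
    refine (Polynomial.natDegree_le_sum_of_prod _ _ _
      fun i _ => natDegree_lineDeriv_factor x d f e i).trans ?_
    rw [sum_sub_eq_degree_sub h]
    exact Nat.sub_le_sub_right (by
      simpa [Finsupp.degree_eq_sum, Finsupp.sum_fintype] using le_totalDegree hf) _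
  · rw [prod_choose_eq_zero _ h]
    simp

/-- Only monomials of top degree reach this power of the line parameter, and they contribute through
`d` alone. The coefficient does not depend on `x`, so one good `d` serves all parallel lines. -/
lemma coeff_lineDeriv (P : MvPolynomial σ K) (x d : σ → K) {e : σ →₀ ℕ}
    (he : e.degree ≤ P.totalDegree) :
    (lineDeriv P x d e).coeff (P.totalDegree - e.degree) =
      coeff e (taylorAt d (homogeneousComponent P.totalDegree P)) := by
  rw [lineDeriv, coeff_taylorAt _ _ _ subset_rfl, Polynomial.finsetSum_coeff,
    coeff_taylorAt (S := P.support) _ _ _ ?_]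
  · refine Finset.sum_congr rfl fun f hf => ?_
    have hfd : f.degree ≤ P.totalDegree := by
      simpa [Finsupp.degree_eq_sum, Finsupp.sum_fintype] using le_totalDegree hf
    rw [coeff_homogeneousComponent, Algebra.algebraMap_self, RingHom.id_apply,
      Polynomial.algebraMap_eq, Polynomial.coeff_C_mul]
    by_cases h : e ≤ f
    · split_ifs with hd
      · rw [← hd, ← sum_sub_eq_degree_sub h, Polynomial.coeff_prod_sum_of_natDegree_le _ _ _
          fun i _ => natDegree_lineDeriv_factor x d f e i]
        simp_rw [coeff_lineDeriv_factor]
      · rw [Polynomial.coeff_eq_zero_of_natDegree_lt, mul_zero, zero_mul]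
        refine (Polynomial.natDegree_le_sum_of_prod _ _ _
          fun i _ => natDegree_lineDeriv_factor x d f e i).trans_lt ?_
        rw [sum_sub_eq_degree_sub h]
        have : e.degree ≤ f.degree := by
          rw [Finsupp.degree_eq_sum, Finsupp.degree_eq_sum]
          exact Finset.sum_le_sum fun i _ => h i
        omega
    · rw [prod_choose_eq_zero _ h, prod_choose_eq_zero _ h]
      simp
  · intro f hf
    rw [mem_support_iff, coeff_homogeneousComponent] at hf
    rw [mem_support_iff]
    exact fun h => hf (by simp [h])

/-- `P` vanishes at `x` to order at least `m`. -/
def VanishesToOrder (P : MvPolynomial σ K) (x : σ → K) (m : ℕ) : Prop :=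
  ∀ e : σ →₀ ℕ, e.degree < m → coeff e (taylorAt x P) = 0

/-- Recentred at `x + s • d`, the displacement along the line is `(X - s) • d`. Each surviving
monomial `f` has degree at least `m`, and its `e`-th derivative carries the factor `(X - s) ^ (|f| -
|e|)`. -/
lemma VanishesToOrder.pow_dvd_lineDeriv {P : MvPolynomial σ K} {x d : σ → K} {s : K} {m : ℕ}
    (h : VanishesToOrder P (x + s • d) m) (e : σ →₀ ℕ) :
    (Polynomial.X - Polynomial.C s) ^ (m - e.degree) ∣ lineDeriv P x d e := by
  have hshift : lineDeriv P x d e = coeff e (taylorAt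
      (fun i => (Polynomial.X - Polynomial.C s) * Polynomial.C (d i))
      (taylorAt (x + s • d) P)) := by
    rw [taylorAt_taylorAt, lineDeriv]
    congr 3
    ext1 i
    simp only [Pi.add_apply, Pi.smul_apply, smul_eq_mul, Polynomial.algebraMap_eq, map_add,
      map_mul]
    ring
  rw [hshift, coeff_taylorAt _ _ _ subset_rfl]
  refine Finset.dvd_sum fun f hf => ?_
  by_cases hef : e ≤ f
  · have hm : m ≤ f.degree := by
      by_contra hlt
      exact mem_support_iff.mp hf (h f (by omega))
    apply dvd_mul_of_dvd_right
    simp_rw [mul_pow, ← mul_assoc, mul_right_comm _ _ (Polynomial.C _ ^ _)]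
    rw [Finset.prod_mul_distrib, Finset.prod_pow_eq_pow_sum, sum_sub_eq_degree_sub hef]
    exact dvd_mul_of_dvd_right (pow_dvd_pow _ (by omega)) _
  · rw [prod_choose_eq_zero _ hef]
    simp

end Line

end MvPolynomial

/-! ### Root multiplicities in one variable -/

namespace Polynomial

variable {K : Type*} [Field K] [Fintype K]

lemma sum_rootMultiplicity_le (f : K[X]) : ∑ b, f.rootMultiplicity b ≤ f.natDegree := by
  classical
  simp_rw [← count_roots]
  rw [Multiset.sum_count_eq_card fun a _ => Finset.mem_univ a]
  exact card_roots' f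

/-- Averaging: the `q` root multiplicities sum to at most the degree, so the smallest is at most
`natDegree / q`. -/
lemma exists_taylor_coeff_ne_zero {f : K[X]} (hf : f ≠ 0) :
    ∃ (b : K) (i : ℕ), Fintype.card K * i ≤ f.natDegree ∧ (taylor b f).coeff i ≠ 0 := by
  obtain ⟨b, -, hb⟩ := Finset.exists_min_image Finset.univ (fun b : K => f.rootMultiplicity b)
    Finset.univ_nonempty
  refine ⟨b, f.rootMultiplicity b, ?_, ?_⟩
  · refine le_trans ?_ (sum_rootMultiplicity_le f)
    rw [← smul_eq_mul]
    exact Finset.card_nsmul_le_sum _ _ _ hb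
  · rw [rootMultiplicity_eq_natTrailingDegree, ← taylor_apply]
    exact trailingCoeff_nonzero_iff_nonzero.mpr (by simpa using hf)

lemma eq_zero_of_pow_dvd_of_natDegree_lt_sum {f : K[X]} (k : K → ℕ)
    (hdvd : ∀ b, (X - C b) ^ k b ∣ f) (hlt : f.natDegree < ∑ b, k b) : f = 0 := by
  by_contra hf
  refine hlt.not_ge (le_trans (Finset.sum_le_sum fun b _ => ?_) (sum_rootMultiplicity_le f))
  exact (le_rootMultiplicity_iff hf).mpr (hdvd b)

end Polynomial

/-! ### Schwartz–Zippel with multiplicities -/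

namespace MvPolynomial

variable {K : Type*} [Field K]

lemma finSuccEquiv_taylorAt {n : ℕ} (b : K) (a : Fin n → K) (P : MvPolynomial (Fin (n + 1)) K) :
    finSuccEquiv K n (taylorAt (Fin.cons b a : Fin (n + 1) → K) P) =
      Polynomial.taylor (C b) ((finSuccEquiv K n P).map (taylorAt (K := K) a).toRingHom) := by
  have : (finSuccEquiv K n).toAlgHom.comp (taylorAt (Fin.cons b a : Fin (n + 1) → K)) =
      ((Polynomial.taylorAlgHom (R := MvPolynomial (Fin n) K) (C b)).restrictScalars K).comp
        ((Polynomial.mapAlgHom (taylorAt (K := K) a)).comp (finSuccEquiv K n).toAlgHom) := by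
    apply algHom_ext
    intro i
    have hC : ∀ c : K, finSuccEquiv K n (C c) = Polynomial.C (C c) :=
      fun c => ((finSuccEquiv K n).symm_apply_eq.mp
        (RingHom.congr_fun (finSuccEquiv_comp_C_eq_C n) c)).symm
    refine Fin.cases ?_ (fun j => ?_) i
    · simp [finSuccEquiv_X_zero, hC]
    · simp [finSuccEquiv_X_succ, hC]
  exact DFunLike.congr_fun this P

lemma coeff_coeff_taylor {σ : Type*} (b : K) (Q : Polynomial (MvPolynomial σ K))
    (α : σ →₀ ℕ) (i : ℕ) {g : Polynomial K} (hg : ∀ j, g.coeff j = coeff α (Q.coeff j)) :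
    coeff α ((Polynomial.taylor (C b) Q).coeff i) = (Polynomial.taylor b g).coeff i := by
  rw [Polynomial.taylor_coeff, Polynomial.taylor_coeff,
    Polynomial.eval_eq_sum_range' (n := Q.natDegree + 1),
    Polynomial.eval_eq_sum_range' (n := Q.natDegree + 1), coeff_sum]
  · refine Finset.sum_congr rfl fun j _ => ?_
    rw [Polynomial.hasseDeriv_coeff, Polynomial.hasseDeriv_coeff, ← C_eq_coe_nat, ← map_pow,
      mul_right_comm, ← map_mul, coeff_C_mul, hg]
    ring
  · refine Nat.lt_succ_of_le ((Polynomial.natDegree_hasseDeriv_le _ _).trans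
      ((Nat.sub_le _ _).trans ?_))
    rw [Polynomial.natDegree_le_iff_coeff_eq_zero]
    intro j hj
    rw [hg, Polynomial.coeff_eq_zero_of_natDegree_lt hj, coeff_zero]
  · exact Nat.lt_succ_of_le ((Polynomial.natDegree_hasseDeriv_le _ _).trans (Nat.sub_le _ _))

/-- The Schwartz–Zippel lemma with multiplicities: a nonzero polynomial over a field with `q`
elements has a point at which it vanishes to order at most `totalDegree / q`. -/
theorem exists_coeff_taylorAt_ne_zero [Fintype K] {n : ℕ} (P : MvPolynomial (Fin n) K)
    (hP : P ≠ 0) : ∃ (a : Fin n → K) (e : Fin n →₀ ℕ),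
      Fintype.card K * e.degree ≤ P.totalDegree ∧ coeff e (taylorAt a P) ≠ 0 := by
  induction n with
  | zero =>
    refine ⟨Fin.elim0, 0, by simp, ?_⟩
    obtain ⟨c, rfl⟩ := C_surjective (Fin 0) P
    simpa using hP
  | succ n ih =>
    set Q := finSuccEquiv K n P with hQ
    have hQ0 : Q ≠ 0 := by simpa [hQ] using hP
    have hlead : Q.coeff Q.natDegree ≠ 0 := by simpa using hQ0
    -- Induction is applied to the leading coefficient in the first variable, whose total degree
    -- plus `Q.natDegree` is at most that of `P`.
    obtain ⟨a, α, hα, hne⟩ := ih _ hlead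
    set Q' := Q.map (taylorAt (K := K) a).toRingHom with hQ'
    have hQ'c : ∀ j, Q'.coeff j = taylorAt a (Q.coeff j) := fun j => by simp [hQ']
    -- The `α`-th Hasse derivative at `a` in the remaining variables, as a polynomial in the first;
    -- its top coefficient is nonzero by the choice of `a` and `α`.
    let g : Polynomial K := ∑ j ∈ Finset.range (Q.natDegree + 1),
      Polynomial.monomial j (coeff α (Q'.coeff j))
    have hg : ∀ j, g.coeff j = coeff α (Q'.coeff j) := by
      intro j
      simp only [g, Polynomial.finsetSum_coeff, Polynomial.coeff_monomial, Finset.sum_ite_eq',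
        Finset.mem_range]
      split_ifs with h
      · rfl
      · rw [hQ'c, Polynomial.coeff_eq_zero_of_natDegree_lt (by omega), map_zero, coeff_zero]
    have hg0 : g ≠ 0 := by
      intro h
      apply hne
      rw [← hQ'c, ← hg, h, Polynomial.coeff_zero]
    have hgd : g.natDegree ≤ Q.natDegree := by
      rw [Polynomial.natDegree_le_iff_coeff_eq_zero]
      intro j hj
      rw [hg, hQ'c, Polynomial.coeff_eq_zero_of_natDegree_lt hj, map_zero, coeff_zero]
    obtain ⟨b, i, hi, hgi⟩ := Polynomial.exists_taylor_coeff_ne_zero hg0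
    refine ⟨Fin.cons b a, Finsupp.cons i α, ?_, ?_⟩
    · have h1 := totalDegree_coeff_finSuccEquiv_add_le P Q.natDegree hlead
      have h2 : (Finsupp.cons i α).degree = i + α.degree := by
        simp [Finsupp.degree_eq_sum, Fin.sum_univ_succ]
      rw [h2, mul_add]
      rw [← hQ] at h1
      omega
    · rw [← finSuccEquiv_coeff_coeff, finSuccEquiv_taylorAt, coeff_coeff_taylor b _ α i hg]
      exact hgi

end MvPolynomial

/-! ### Interpolation by dimension count -/

namespace MvPolynomial

/-- The exponents of the monomials in `n` variables of degree less than `m`. -/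
def lowExponents (n m : ℕ) : Finset (Fin n →₀ ℕ) :=
  (Finset.range m).biUnion fun j => Finset.univ.finsuppAntidiag j

lemma mem_lowExponents {n m : ℕ} {e : Fin n →₀ ℕ} : e ∈ lowExponents n m ↔ e.degree < m := by
  simp [lowExponents, Finset.mem_finsuppAntidiag, Finsupp.degree_eq_sum]

lemma card_lowExponents_succ (n m : ℕ) : (lowExponents n (m + 1)).card = (m + n).choose n := by
  rw [lowExponents, Finset.card_biUnion]
  · simp_rw [Finset.card_finsuppAntidiag_nat_eq_multichoose, Finset.card_univ, Fintype.card_fin]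
    exact Nat.sum_range_multichoose m n
  · intro i _ j _ hij
    rw [Function.onFun, Finset.disjoint_left]
    intro e he he'
    rw [Finset.mem_finsuppAntidiag] at he he'
    exact hij (he.1.symm.trans he'.1)

lemma card_lowExponents_le (n m : ℕ) :
    ((lowExponents n m).card : ℝ) ≤ ((m : ℝ) + n) ^ n / n.factorial := by
  cases m with
  | zero =>
    simp only [lowExponents, Finset.range_zero, Finset.biUnion_empty, Finset.card_empty,
      Nat.cast_zero]
    positivity
  | succ m =>
    rw [card_lowExponents_succ]
    refine (Nat.choose_le_pow_div n (m + n)).trans ?_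
    push_cast
    gcongr
    linarith

lemma le_card_lowExponents_succ (n m : ℕ) :
    ((m : ℝ) + 1) ^ n / n.factorial ≤ ((lowExponents n (m + 1)).card : ℝ) := by
  rw [card_lowExponents_succ]
  have := Nat.pow_le_choose (α := ℝ) n (m + n)
  rw [show m + n + 1 - n = m + 1 by omega] at this
  simpa using this

variable {K : Type*} [Field K] [Fintype K] {n : ℕ}

theorem exists_vanishesToOrder (m : (Fin n → K) → ℕ) (D : ℕ)
    (h : ∑ x, (lowExponents n (m x)).card < (lowExponents n (D + 1)).card) :
    ∃ P : MvPolynomial (Fin n) K, P ≠ 0 ∧ P.totalDegree ≤ D ∧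
      ∀ x, VanishesToOrder P x (m x) := by
  classical
  let toPoly : (lowExponents n (D + 1) → K) →ₗ[K] MvPolynomial (Fin n) K :=
    ∑ f, (monomial f.1).comp (LinearMap.proj f)
  have htoPoly : ∀ c, toPoly c = ∑ f, monomial f.1 (c f) := fun c => by simp [toPoly]
  let T : (lowExponents n (D + 1) → K) →ₗ[K] ((Σ x, lowExponents n (m x)) → K) :=
    LinearMap.pi fun i => (lcoeff K i.2.1).comp ((taylorAt (K := K) i.1).toLinearMap.comp toPoly)
  have hker : LinearMap.ker T ≠ ⊥ := by
    apply LinearMap.ker_ne_bot_of_finrank_lt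
    simpa using h
  obtain ⟨c, hc, hc0⟩ := Submodule.exists_mem_ne_zero_of_ne_bot hker
  have hcoeff : ∀ f : lowExponents n (D + 1), coeff f.1 (toPoly c) = c f := by
    intro f
    rw [htoPoly, coeff_sum]
    simp [coeff_monomial]
  refine ⟨toPoly c, ?_, ?_, ?_⟩
  · intro h0
    apply hc0
    ext f
    rw [← hcoeff, h0, coeff_zero, Pi.zero_apply]
  · rw [htoPoly]
    refine totalDegree_finsetSum_le fun f _ => (totalDegree_monomial_le _ _).trans ?_
    have := mem_lowExponents.mp f.2
    rw [Finsupp.degree_eq_sum] at this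
    rw [Finsupp.sum_fintype _ _ (by simp)]
    simp only [id_eq]
    omega
  · intro x e he
    exact congr_fun (LinearMap.mem_ker.mp hc) ⟨x, e, mem_lowExponents.mpr he⟩

/-- A direction must be nonzero. If Schwartz–Zippel returns the origin, homogeneity forces `|e| =
D`, hence `q * D ≤ D` and `D = 0`; the form is then constant and any point serves. -/
lemma exists_ne_zero_coeff_taylorAt_ne_zero (hn : n ≠ 0) {P : MvPolynomial (Fin n) K} {D : ℕ}
    (hhom : P.IsHomogeneous D) (hP : P ≠ 0) : ∃ (a : Fin n → K) (e : Fin n →₀ ℕ), a ≠ 0 ∧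
      Fintype.card K * e.degree ≤ D ∧ coeff e (taylorAt a P) ≠ 0 := by
  obtain ⟨a, e, he, hne⟩ := exists_coeff_taylorAt_ne_zero P hP
  rw [hhom.totalDegree hP] at he
  by_cases ha : a = 0
  · have hid : taylorAt (K := K) (0 : Fin n → K) = AlgHom.id K _ := by
      apply algHom_ext
      simp
    subst ha
    rw [hid, AlgHom.id_apply] at hne
    have hdeg : e.degree = D := by
      by_contra h
      exact hne (hhom.coeff_eq_zero h)
    have hq := Fintype.one_lt_card (α := K)
    have hD : D = 0 := by
      rw [hdeg] at he
      by_contra h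
      nlinarith [Nat.pos_of_ne_zero h]
    subst hD
    obtain ⟨i⟩ : Nonempty (Fin n) := ⟨⟨0, Nat.pos_of_ne_zero hn⟩⟩
    refine ⟨1, e, fun h => one_ne_zero (congr_fun h i), he, ?_⟩
    rw [totalDegree_eq_zero_iff_eq_C.mp (hhom.totalDegree hP)] at hne ⊢
    simpa using hne
  · exact ⟨a, e, ha, he, hne⟩

end MvPolynomial

/-! ### A direction with small line sums -/

section Direction

variable {K : Type*} [Field K] [Fintype K] {n : ℕ}

open MvPolynomial

/-- If the multiplicities `m` are so small that some nonzero polynomial of degree at most `D`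
attains them, then there is a direction in which every line has small total multiplicity. -/
theorem exists_direction_sum_multiplicity_le (hn : n ≠ 0) (m : (Fin n → K) → ℕ) (D : ℕ)
    (h : ∑ x, (lowExponents n (m x)).card < (lowExponents n (D + 1)).card) :
    ∃ d : Fin n → K, d ≠ 0 ∧ ∀ x,
      Fintype.card K * ∑ s : K, m (x + s • d) ≤ (2 * Fintype.card K - 1) * D := by
  obtain ⟨P, hP, hPD, hvan⟩ := exists_vanishesToOrder m D h
  have htop : homogeneousComponent P.totalDegree P ≠ 0 := by
    obtain ⟨f, hf, hfd⟩ := Finset.exists_mem_eq_sup P.support (support_nonempty.mpr hP)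
      (fun s => s.sum fun _ e => e)
    intro h0
    have h1 := congr_arg (coeff f) h0
    rw [coeff_homogeneousComponent, if_pos, coeff_zero] at h1
    · exact mem_support_iff.mp hf h1
    · rw [totalDegree, hfd, Finsupp.degree_eq_sum, Finsupp.sum_fintype _ _ (by simp)]
  obtain ⟨d, e, hd, he, hne⟩ := exists_ne_zero_coeff_taylorAt_ne_zero hn
    (homogeneousComponent_isHomogeneous P.totalDegree P) htop
  refine ⟨d, hd, fun x => ?_⟩
  by_contra! hlt
  have hq := Fintype.one_lt_card (α := K)
  set q := Fintype.card K with hqdef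
  have heD : e.degree ≤ P.totalDegree := by nlinarith
  rw [← coeff_lineDeriv P x d heD] at hne
  apply hne
  rw [Polynomial.eq_zero_of_pow_dvd_of_natDegree_lt_sum (fun s => m (x + s • d) - e.degree)
    (fun s => (hvan _).pow_dvd_lineDeriv e), Polynomial.coeff_zero]
  refine (natDegree_lineDeriv_le P x d e).trans_lt ?_
  -- Truncated subtraction loses at most `|e|` at each of the `q` points.
  have hsum : ∑ s : K, m (x + s • d) ≤ ∑ s : K, (m (x + s • d) - e.degree) + q * e.degree := by
    rw [hqdef, ← Finset.card_univ, ← smul_eq_mul, ← Finset.sum_const, ← Finset.sum_add_distrib]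
    exact Finset.sum_le_sum fun s _ => by omega
  set A := ∑ s : K, m (x + s • d)
  set B := ∑ s : K, (m (x + s • d) - e.degree)
  suffices P.totalDegree + q * e.degree < A + e.degree by omega
  obtain ⟨r, hr⟩ : ∃ r, q = r + 1 := ⟨q - 1, by omega⟩
  rw [show 2 * q - 1 = 2 * r + 1 by omega] at hlt
  rw [hr] at he hlt ⊢
  refine lt_of_mul_lt_mul_left (a := r + 1) ?_ (Nat.zero_le _)
  nlinarith [Nat.mul_le_mul_left (2 * r + 1) hPD, Nat.mul_le_mul_left r he]

-- Multiplicities `⌊N * r x⌋` and degree `⌊N * (1 + δ)⌋` satisfy the dimension count for large `N`.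
-- The additive `δ` pays for rounding at the `q` points of a line, an error of at most `q / N`.
open Filter Topology in
lemma exists_direction_sum_le_add (hn : n ≠ 0) (r : (Fin n → K) → ℝ) (hr : ∀ x, 0 ≤ r x)
    (hsum : ∑ x, r x ^ n ≤ 1) {δ : ℝ} (hδ : 0 < δ) : ∃ d : Fin n → K, d ≠ 0 ∧ ∀ x,
      ∑ s : K, r (x + s • d) ≤ (2 - (Fintype.card K : ℝ)⁻¹) * (1 + δ) + δ := by
  set q := Fintype.card K with hqdef
  have hq : 1 < q := Fintype.one_lt_card
  have hlim : Tendsto (fun N : ℕ => ∑ x, (r x + (n : ℝ) / N) ^ n) atTop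
      (𝓝 (∑ x, (r x + 0) ^ n)) :=
    tendsto_finsetSum _ fun x _ =>
      (tendsto_const_nhds.add (tendsto_const_div_atTop_nhds_zero_nat (n : ℝ))).pow n
  have hlim' := tendsto_const_div_atTop_nhds_zero_nat (q : ℝ)
  have h1 : ∑ x, (r x + 0) ^ n < (1 + δ) ^ n := by
    simp only [add_zero]
    exact hsum.trans_lt (one_lt_pow₀ (by linarith) hn)
  obtain ⟨N, hN1, hN2, hN0⟩ := ((hlim.eventually_lt_const h1).and
    ((hlim'.eventually_lt_const hδ).and (eventually_gt_atTop 0))).exists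
  have hN : (0 : ℝ) < N := by exact_mod_cast hN0
  set D := ⌊(N : ℝ) * (1 + δ)⌋₊
  have hDle : (D : ℝ) ≤ N * (1 + δ) := Nat.floor_le (by positivity)
  have hDlt : (N : ℝ) * (1 + δ) < D + 1 := Nat.lt_floor_add_one _
  have hmle : ∀ x, ((⌊(N : ℝ) * r x⌋₊ : ℕ) : ℝ) ≤ N * r x :=
    fun x => Nat.floor_le (mul_nonneg hN.le (hr x))
  obtain ⟨d, hd, hline⟩ := exists_direction_sum_multiplicity_le hn
    (fun x => ⌊(N : ℝ) * r x⌋₊) D (by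
      rify
      refine lt_of_lt_of_le ?_ (le_card_lowExponents_succ n D)
      refine (Finset.sum_le_sum fun x _ => card_lowExponents_le n _).trans_lt ?_
      rw [← Finset.sum_div]
      gcongr
      calc ∑ x, (((⌊(N : ℝ) * r x⌋₊ : ℕ) : ℝ) + n) ^ n
          ≤ ∑ x, (N : ℝ) ^ n * (r x + (n : ℝ) / N) ^ n := by
            refine Finset.sum_le_sum fun x _ => ?_
            rw [← mul_pow, mul_add, mul_div_cancel₀ _ hN.ne']
            gcongr
            exact hmle x
        _ < (N : ℝ) ^ n * (1 + δ) ^ n := by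
            rw [← Finset.mul_sum]
            gcongr
        _ ≤ ((D : ℝ) + 1) ^ n := by
            rw [← mul_pow]
            gcongr)
  refine ⟨d, hd, fun x => ?_⟩
  have hx := hline x
  rify at hx
  rw [← hqdef, Nat.cast_sub (by omega)] at hx
  push_cast at hx
  have hfloor : (N : ℝ) * ∑ s : K, r (x + s • d) ≤
      ∑ s : K, ((⌊(N : ℝ) * r (x + s • d)⌋₊ : ℕ) : ℝ) + q := by
    have : (q : ℝ) = ∑ _s : K, (1 : ℝ) := by simp [hqdef]
    rw [this, Finset.mul_sum, ← Finset.sum_add_distrib]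
    exact Finset.sum_le_sum fun s _ => (Nat.lt_floor_add_one _).le
  have hq0 : (0 : ℝ) < q := by positivity
  have hq1 : (1 : ℝ) < q := by exact_mod_cast hq
  have hx' : ∑ s : K, ((⌊(N : ℝ) * r (x + s • d)⌋₊ : ℕ) : ℝ) ≤ (2 - (q : ℝ)⁻¹) * D := by
    refine le_of_mul_le_mul_left ?_ hq0
    have : (q : ℝ) * ((2 - (q : ℝ)⁻¹) * D) = (2 * q - 1) * D := by field_simp
    rw [this]
    exact hx
  have hC : 0 ≤ 2 - (q : ℝ)⁻¹ := by linarith [inv_lt_one_of_one_lt₀ hq1]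
  rw [div_lt_iff₀ hN] at hN2
  refine le_of_mul_le_mul_left ?_ hN
  nlinarith [mul_le_mul_of_nonneg_left hDle hC]

/-- A nonnegative function whose `n`-th powers sum to at most `1` has a direction in which all
its line sums are at most `2 - 1 / q`. -/
theorem exists_direction_sum_le (hn : n ≠ 0) (r : (Fin n → K) → ℝ) (hr : ∀ x, 0 ≤ r x)
    (hsum : ∑ x, r x ^ n ≤ 1) : ∃ d : Fin n → K, d ≠ 0 ∧ ∀ x,
      ∑ s : K, r (x + s • d) ≤ 2 - (Fintype.card K : ℝ)⁻¹ := by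
  classical
  by_contra! hcon
  set c := 2 - (Fintype.card K : ℝ)⁻¹ with hc
  have hc2 : c ≤ 2 := by
    rw [hc]
    linarith [inv_nonneg.mpr (Nat.cast_nonneg (α := ℝ) (Fintype.card K))]
  choose! y hy using hcon
  obtain ⟨d₀, hd₀, -⟩ := exists_direction_sum_le_add hn r hr hsum one_pos
  -- There are finitely many directions, so if each has a line exceeding `c`, the excesses have a
  -- positive minimum. A quarter of it works as `δ`, since `c * (1 + δ) + δ ≤ c + 3 * δ` by `c ≤ 2`.
  obtain ⟨d₁, hd₁, hmin⟩ := Finset.exists_min_image (Finset.univ.filter fun d : Fin n → K => d ≠ 0)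
    (fun d => ∑ s : K, r (y d + s • d)) ⟨d₀, by simpa using hd₀⟩
  have hgap := hy d₁ (by simpa using hd₁)
  obtain ⟨d, hd, hle⟩ := exists_direction_sum_le_add hn r hr hsum
    (δ := (∑ s : K, r (y d₁ + s • d₁) - c) / 4) (by linarith)
  have h1 := hmin d (by simpa using hd)
  have h2 := hle (y d)
  rw [← hc] at h2
  nlinarith

end Direction

/-! ### Projecting along lines, once and then repeatedly -/

section Projection

variable {K : Type*} [Field K]

lemma exists_linearMap_ker_eq_span {n : ℕ} {d : Fin (n + 1) → K} (hd : d ≠ 0) :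
    ∃ φ : (Fin (n + 1) → K) →ₗ[K] (Fin n → K), Function.Surjective φ ∧
      LinearMap.ker φ = Submodule.span K {d} := by
  have hrank : Module.finrank K ((Fin (n + 1) → K) ⧸ Submodule.span K {d}) =
      Module.finrank K (Fin n → K) := by
    have := Submodule.finrank_quotient_add_finrank (Submodule.span K {d})
    rw [finrank_span_singleton hd, Module.finrank_fin_fun] at this
    rw [Module.finrank_fin_fun]
    omega
  let e := LinearEquiv.ofFinrankEq _ _ hrank
  refine ⟨e.toLinearMap.comp (Submodule.mkQ _), ?_, ?_⟩
  · exact e.surjective.comp (Submodule.mkQ_surjective _)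
  · rw [LinearEquiv.ker_comp, Submodule.ker_mkQ]

variable [Fintype K] [DecidableEq K]

lemma sum_fiber_eq_sum_line {n m : ℕ} {d : Fin n → K} (hd : d ≠ 0)
    {φ : (Fin n → K) →ₗ[K] (Fin m → K)} (hφ : LinearMap.ker φ = Submodule.span K {d})
    (p : (Fin n → K) → ℝ) (x : Fin n → K) :
    ∑ v with φ v = φ x, p v = ∑ s : K, p (x + s • d) := by
  symm
  refine Finset.sum_bij (fun s _ => x + s • d) ?_ ?_ ?_ (fun _ _ => rfl)
  · intro s _
    have : φ d = 0 := by
      rw [← LinearMap.mem_ker, hφ]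
      exact Submodule.mem_span_singleton_self d
    simp [this]
  · intro s _ t _ hst
    exact smul_left_injective K hd (add_left_cancel hst)
  · intro v hv
    rw [Finset.mem_filter_univ, ← sub_eq_zero, ← map_sub, ← LinearMap.mem_ker, hφ,
      Submodule.mem_span_singleton] at hv
    obtain ⟨s, hs⟩ := hv
    exact ⟨s, Finset.mem_univ s, by rw [hs]; abel⟩

/-- A distribution on `K ^ (n + 1)` with all weights at most `M` has a projection along a line
with all weights at most `(2 - 1 / q) * M ^ (n / (n + 1))`. -/
lemma exists_projection_sum_fiber_le {n : ℕ} (p : (Fin (n + 1) → K) → ℝ)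
    (hp : ∀ v, 0 ≤ p v) (hsum : ∑ v, p v = 1) {M : ℝ} (hM : ∀ v, p v ≤ M) :
    ∃ φ : (Fin (n + 1) → K) →ₗ[K] (Fin n → K), Function.Surjective φ ∧
      ∀ w, ∑ v with φ v = w, p v ≤
        (2 - (Fintype.card K : ℝ)⁻¹) * M ^ ((n : ℝ) / (n + 1)) := by
  set r : (Fin (n + 1) → K) → ℝ := fun v => p v ^ (((n + 1 : ℕ) : ℝ)⁻¹) with hr
  obtain ⟨d, hd, hline⟩ := exists_direction_sum_le n.succ_ne_zero r
    (fun v => Real.rpow_nonneg (hp v) _) (by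
      simp only [hr, Real.rpow_inv_natCast_pow (hp _) n.succ_ne_zero]
      exact hsum.le)
  obtain ⟨φ, hφ, hker⟩ := exists_linearMap_ker_eq_span hd
  refine ⟨φ, hφ, fun w => ?_⟩
  obtain ⟨x, rfl⟩ := hφ w
  rw [sum_fiber_eq_sum_line hd hker]
  have hM0 : 0 ≤ M := (hp 0).trans (hM 0)
  have hle : ∀ v, p v ≤ r v * M ^ ((n : ℝ) / (n + 1)) := by
    intro v
    have hexp : ((n + 1 : ℕ) : ℝ)⁻¹ + (n : ℝ) / (n + 1) = 1 := by
      push_cast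
      field_simp
      ring
    calc p v = r v * p v ^ ((n : ℝ) / (n + 1)) := by
          rw [hr]
          simp only
          rw [← Real.rpow_add_of_nonneg (hp v) (by positivity) (by positivity), hexp,
            Real.rpow_one]
      _ ≤ r v * M ^ ((n : ℝ) / (n + 1)) :=
          mul_le_mul_of_nonneg_left (Real.rpow_le_rpow (hp v) (hM v) (by positivity))
            (Real.rpow_nonneg (hp v) _)
  calc ∑ s : K, p (x + s • d) ≤ (∑ s : K, r (x + s • d)) * M ^ ((n : ℝ) / (n + 1)) := by
        rw [Finset.sum_mul]
        exact Finset.sum_le_sum fun s _ => hle _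
    _ ≤ _ := mul_le_mul_of_nonneg_right (hline x) (Real.rpow_nonneg hM0 _)

theorem exists_linearMap_sum_fiber_le {m : ℕ} (hm : m ≠ 0) (k : ℕ) (p : (Fin (m + k) → K) → ℝ)
    (hp : ∀ v, 0 ≤ p v) (hsum : ∑ v, p v = 1) {M : ℝ} (hM : ∀ v, p v ≤ M) :
    ∃ φ : (Fin (m + k) → K) →ₗ[K] (Fin m → K), Function.Surjective φ ∧
      ∀ w, ∑ v with φ v = w, p v ≤
        (2 - (Fintype.card K : ℝ)⁻¹) ^ k * M ^ ((m : ℝ) / (m + k)) := by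
  have hm0 : (0 : ℝ) < m := by exact_mod_cast Nat.pos_of_ne_zero hm
  induction k generalizing M with
  | zero =>
    refine ⟨LinearMap.id, Function.surjective_id, fun w => ?_⟩
    have : ∑ v with (LinearMap.id : (Fin (m + 0) → K) →ₗ[K] (Fin (m + 0) → K)) v = w, p v
        = p w := by simp [Finset.sum_filter]
    rw [this]
    simpa [hm0.ne'] using hM w
  | succ k ih =>
    obtain ⟨φ, hφ, hφM⟩ := exists_projection_sum_fiber_le (n := m + k) p hp hsum hM
    obtain ⟨ψ, hψ, hψM⟩ := ih (fun w => ∑ v with φ v = w, p v)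
      (fun w => Finset.sum_nonneg fun v _ => hp v)
      (by rw [Finset.sum_fiberwise]; exact hsum) hφM
    refine ⟨ψ.comp φ, hψ.comp hφ, fun w => ?_⟩
    have hfib : ∑ v with (ψ.comp φ) v = w, p v = ∑ u with ψ u = w, ∑ v with φ v = u, p v := by
      rw [Finset.sum_sigma']
      refine Finset.sum_bij (fun v _ => ⟨φ v, v⟩) ?_ ?_ ?_ ?_
      · intro v hv
        simpa using hv
      · intro v _ v' _ h
        exact (Sigma.mk.inj_iff.mp h).2.eq
      · rintro ⟨u, v⟩ h
        simp only [Finset.mem_sigma, Finset.mem_filter_univ] at h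
        obtain ⟨h1, rfl⟩ := h
        exact ⟨v, by simpa using h1, rfl⟩
      · intro v _
        rfl
    refine hfib.le.trans ((hψM w).trans ?_)
    set c := 2 - (Fintype.card K : ℝ)⁻¹ with hc
    have hc1 : 1 ≤ c := by
      have : ((Fintype.card K : ℝ))⁻¹ ≤ 1 := inv_le_one_of_one_le₀ (by
        exact_mod_cast Fintype.card_pos)
      rw [hc]
      linarith
    have hM0 : 0 ≤ M := (hp 0).trans (hM 0)
    have hexp : ((m + k : ℕ) : ℝ) / ((m + k : ℕ) + 1) * ((m : ℝ) / (m + k)) =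
        (m : ℝ) / (m + (k + 1 : ℕ)) := by
      push_cast
      field_simp
      ring
    rw [Real.mul_rpow (by linarith) (Real.rpow_nonneg hM0 _), ← Real.rpow_mul hM0, hexp,
      pow_succ, mul_assoc]
    gcongr
    -- The later steps shrink the exponent of the first constant; as `c ≥ 1`, restoring it to `1`
    -- only weakens the bound.
    calc c ^ ((m : ℝ) / (m + k)) ≤ c ^ (1 : ℝ) := by
          apply Real.rpow_le_rpow_of_exponent_le hc1
          rw [div_le_one (by positivity)]
          linarith [Nat.cast_nonneg (α := ℝ) k]
      _ = c := Real.rpow_one c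

end Projection

/-! ### From weights to min-entropy -/

theorem mainTheorem2 {F : Type*} [Field F] [Fintype F]
    [MeasurableSpace F] [MeasurableSingletonClass F]
    (q : ℕ) (hq : Fintype.card F = q)
    (n k : ℕ) (hk : 1 ≤ k) (hkn : k < n)
    {Ω : Type*} [MeasurableSpace Ω] (μ : Measure Ω) [IsProbabilityMeasure μ]
    (R : Ω → (Fin n → F)) (hR : Measurable R) :
    ∃ φ : (Fin n → F) →ₗ[F] (Fin (n - k) → F),
      Function.Surjective φ ∧
        minEntropy q μ (fun ω => φ (R ω)) ≥
          (((n : ℝ) - (k : ℝ)) / (n : ℝ)) * minEntropy q μ R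
            - (k : ℝ) * Real.logb (q : ℝ) (2 - (q : ℝ)⁻¹) := by
  classical
  obtain ⟨m, rfl⟩ : ∃ m, n = m + k := ⟨n - k, by omega⟩
  have hm : m ≠ 0 := by omega
  rw [Nat.add_sub_cancel]
  set p : (Fin (m + k) → F) → ℝ := fun v => μ.real (R ⁻¹' {v}) with hp
  have hmeas : ∀ v, MeasurableSet (R ⁻¹' {v}) := fun v => hR (measurableSet_singleton v)
  have hfiber : ∀ S : Finset (Fin (m + k) → F), ∑ v ∈ S, p v = μ.real (R ⁻¹' S) := fun S =>
    sum_measureReal_preimage_singleton S fun v _ => hmeas v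
  have hsum : ∑ v, p v = 1 := by
    rw [hfiber]
    simp
  have hbdd : BddAbove (Set.range p) := Set.finite_range p |>.bddAbove
  set M := ⨆ v, p v with hM
  have hMle : ∀ v, p v ≤ M := le_ciSup hbdd
  have hp0 : ∀ v, 0 ≤ p v := fun v => measureReal_nonneg
  obtain ⟨φ, hφ, hφM⟩ := exists_linearMap_sum_fiber_le hm k p hp0 hsum hMle
  refine ⟨φ, hφ, ?_⟩
  have hpush : ∀ w, μ.real ((fun ω => φ (R ω)) ⁻¹' {w}) = ∑ v with φ v = w, p v := by
    intro w
    rw [hfiber]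
    congr 1
    ext ω
    simp
  rw [hq] at hφM
  have hq1 : 1 < (q : ℝ) := by
    rw [← hq]
    exact_mod_cast Fintype.one_lt_card
  have hc : 0 < 2 - (q : ℝ)⁻¹ := by linarith [inv_lt_one_of_one_lt₀ hq1]
  have hMpos : 0 < M := by
    by_contra! h
    have : ∑ v, p v ≤ 0 := Finset.sum_nonpos fun v _ => (hMle v).trans h
    linarith
  have hpos : 0 < ⨆ w, μ.real ((fun ω => φ (R ω)) ⁻¹' {w}) := by
    obtain ⟨v, hv⟩ : ∃ v, 0 < p v := by
      by_contra! h
      have : ∑ v, p v ≤ 0 := Finset.sum_nonpos fun v _ => h v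
      linarith
    refine lt_of_lt_of_le ?_ (le_ciSup (Set.finite_range _).bddAbove (φ v))
    rw [hpush]
    exact hv.trans_le (Finset.single_le_sum (f := p) (fun v _ => hp0 v) (by simp))
  have hlog : Real.logb q (⨆ w, μ.real ((fun ω => φ (R ω)) ⁻¹' {w})) ≤
      k * Real.logb q (2 - (q : ℝ)⁻¹) + (m : ℝ) / (m + k) * Real.logb q M := by
    rw [← Real.logb_pow, ← Real.logb_rpow_eq_mul_logb_of_pos hMpos,
      ← Real.logb_mul (by positivity) (by positivity)]
    refine Real.logb_le_logb_of_le hq1 hpos (ciSup_le fun w => ?_)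
    rw [hpush]
    exact hφM w
  unfold minEntropy
  push_cast
  rw [add_sub_cancel_right]
  linarith
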